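/- Write $e(t)=e^{2\pi i t}$. Let $\theta\in\mathbb R$, $q\ge 1$, $p'\ge 0$ and $p_0$ be such that $q,p',p_0$ are integers, $p_0p'\equiv 1 \pmod q$, and, with $p=(p')^2$, $$0<\theta-\tfrac pq<\tfrac1{q^3}.$$ Put $a=(\theta-\frac pq)^{1/2}$ and $\beta=\frac1{qa}$. Then $\beta>\sqrt q$; for $q\ge4$ let $\alpha>0$ be the solution of $\beta^2=4(\alpha^2+1)$. *The algebra.* Let $M=\mathbb R\times\mathbb Z_q\times\mathbb Z_q$, identified with its dual by $\langle (x,[n],[m]),(y,[k],[l])\rangle=e(xy+\frac{nk}q+\frac{ml}q)$, and let $G=M\times M$. For $(m,s)\in G$ let $\pi_{(m,s)}$ be the unitary operator $(\pi_{(m,s)}f)(n)=\langle n,s\rangle f(n+m)$ on $L^2(M)$, and put $\mathfrak h((m,s),(m',s'))=\langle m,s'\rangle$. Let $D\subset G$ be the lattice spanned by $(a,[p'],0;0,0,0)$ and $(0,0,0;a,[p'],0)$, let $D^\perp=\{y\in G:\mathfrak h(x,y)\overline{\mathfrak h(y,x)}=1\ \ \forall x\in D\}$, and let $C^*(D^\perp,\bar{\mathfrak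 h})$ be the C*-algebra of bounded operators on $L^2(M)$ generated by the unitaries $\pi_y^*$, $y\in D^\perp$. The elements $$\delta_1=(\beta,[-p_0],0;0,0,0),\quad \delta_2=(0,0,0;\beta,[-p_0],0),\quad \delta_3=(0,0,[1];0,0,0),\quad \delta_4=(0,0,0;0,0,[1])$$ belong to $D^\perp$. Put $V_j=\pi_{\delta_j}^*$, $W_1=V_1V_3^{-p_0}$ and $W_2=V_2V_4^{p_0}$. *The functions.* Let $$h(x)=e^{-\pi\alpha x^2}\sum_{k\in\mathbb Z}e^{-\pi\alpha k^2}e^{\pi\alpha k}\,e\big((\tfrac\beta2k-\tfrac\beta4)x\big),\qquad H(s,t)=\int_{\mathbb R}\overline{h(x)}\,h(x+s)\,e(xt)\,dx,$$ let $\vartheta_2(z,t)=\sum_n e^{\pi it(n+\frac12)^2}e^{2iz(n+\frac12)}$ and $\vartheta_3(z,t)=\sum_n e^{\pi itn^2}e^{2izn}$, let $t_\alpha=4\alpha+\frac2\alpha$, and $$\Gamma(u,v)=e^{\pi\alpha/2}\Big[\vartheta_2(\tfrac\pi2\beta^2v,2i\alpha)\,\vartheta_3(i\tfrac{\pi}{2\alpha}\beta^2u,it_\alpha)+\vartheta_3(\tfrac\pi2\beta^2v,2i\alpha)\,\vartheta_2(i\tfrac{\pi}{2\alpha}\beta^2u,it_\alpha)\Big].$$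 Let $$b=\sqrt{2\alpha}\sum_{n_1,n_2\in\mathbb Z}H(n_1\beta,n_2\beta)\,W_1^{n_1}W_2^{n_2},$$ and let $\psi_0$ be the element obtained from the period one function $\psi_0(t)=\sum_m e^{-\pi\beta^2m^2/(2\alpha)}\Gamma(m,0)\,e(mt)$ by putting $W_2$ for $e(t)$, that is, $\psi_0=\sum_m e^{-\pi\beta^2m^2/(2\alpha)}\Gamma(m,0)\,W_2^m$. **Lemma 3.1.** For $q\ge4$ both series are summable in norm topology (unconditionally) in $C^*(D^\perp,\bar{\mathfrak h})$. As $q\to\infty$, uniformly in all $\theta,p',p_0$ as above, $$\|b-\psi_0\|\to0\qquad\text{and}\qquad\|b-2\|\to0 .$$ In particular, for all sufficiently large $q$ (again uniformly in $\theta,p',p_0$) $b$ is a positive invertible element of $C^*(D^\perp,\bar{\mathfrak h})$, so that $b^{-1/2}$ is defined. -/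

import Mathlib

open MeasureTheory Filter Topology

noncomputable section

namespace FourierProj

/-- `e(t) = exp(2πit)`. -/
def e (t : ℝ) : ℂ := Complex.exp (2 * Real.pi * Complex.I * t)

/-! ### Theta functions and the Gaussian theta function -/

/-- `ϑ₂(z,t) = ∑ₙ exp(πit(n+1/2)²) exp(2iz(n+1/2))`, for `Im t > 0`. -/
def theta2 (z t : ℂ) : ℂ :=
  ∑' n : ℤ, Complex.exp (Real.pi * Complex.I * t * ((n : ℂ) + 1 / 2) ^ 2) *
    Complex.exp (Complex.I * 2 * z * ((n : ℂ) + 1 / 2))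

/-- `ϑ₃(z,t) = ∑ₙ exp(πitn²) exp(2izn)`, for `Im t > 0`. -/
def theta3 (z t : ℂ) : ℂ :=
  ∑' n : ℤ, Complex.exp (Real.pi * Complex.I * t * (n : ℂ) ^ 2) *
    Complex.exp (Complex.I * 2 * z * (n : ℂ))

/-- The Schwartz function
`h(x) = exp(-παx²) ∑ₚ exp(-παp²) exp(παp) e((βp/2 - β/4)x)`. -/
def h (α β x : ℝ) : ℂ :=
  (Real.exp (-Real.pi * α * x ^ 2) : ℂ) *
    ∑' p : ℤ, (Real.exp (-Real.pi * α * (p : ℝ) ^ 2) : ℂ) * (Real.exp (Real.pi * α * p) : ℂ) *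
      e ((β / 2 * p - β / 4) * x)

/-- `H(s,t) = ∫ conj(h(x)) h(x+s) e(xt) dx`. -/
def H (α β s t : ℝ) : ℂ :=
  ∫ x : ℝ, (starRingEnd ℂ) (h α β x) * h α β (x + s) * e (x * t)

/-- `Γ(u,v) = exp(πα/2) [ϑ₂(πβ²v/2, 2iα) ϑ₃(iπβ²u/(2α), it_α)
  + ϑ₃(πβ²v/2, 2iα) ϑ₂(iπβ²u/(2α), it_α)]` with `t_α = 4α + 2/α`. -/
def Gam (α β u v : ℝ) : ℂ :=
  (Real.exp (Real.pi * α / 2) : ℂ) *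
    (theta2 ((Real.pi / 2 * β ^ 2 * v : ℝ) : ℂ) (2 * Complex.I * α) *
        theta3 (Complex.I * ((Real.pi / (2 * α) * β ^ 2 * u : ℝ) : ℂ))
          (Complex.I * ((4 * α + 2 / α : ℝ) : ℂ)) +
      theta3 ((Real.pi / 2 * β ^ 2 * v : ℝ) : ℂ) (2 * Complex.I * α) *
        theta2 (Complex.I * ((Real.pi / (2 * α) * β ^ 2 * u : ℝ) : ℂ))
          (Complex.I * ((4 * α + 2 / α : ℝ) : ℂ)))

/-- The `m`-th Fourier coefficient `e(β²mn/2) exp(-πβ²m²/(2α)) Γ(m,n)` of the period one function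
`ψₙ(t) = ∑ₘ e(β²mn/2) exp(-πβ²m²/(2α)) Γ(m,n) e(mt)`. -/
def psiCoeff (α β : ℝ) (n m : ℤ) : ℂ :=
  e (β ^ 2 * m * n / 2) * (Real.exp (-Real.pi * β ^ 2 * (m : ℝ) ^ 2 / (2 * α)) : ℂ) *
    Gam α β m n

/-! ### The Heisenberg representation for `M = ℝ × ℤ_q × ℤ_q` -/

/-- The self-dual group `M = ℝ × ℤ_q × ℤ_q`. -/
abbrev M (q : ℕ) : Type := ℝ × ZMod q × ZMod q

/-- The Haar measure of `M`: Lebesgue measure on `ℝ`, and mass `q^(-1/2)` for each point of each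
factor `ℤ_q`. -/
def haarM (q : ℕ) : Measure (M q) :=
  (q : ENNReal)⁻¹ • (volume : Measure ℝ).prod
    ((Measure.count : Measure (ZMod q)).prod (Measure.count : Measure (ZMod q)))

/-- `L²(M)`. -/
abbrev L2M (q : ℕ) : Type := Lp ℂ 2 (haarM q)

/-- The group `G = M × M^`, where `M^` is identified with `M`. -/
abbrev G (q : ℕ) : Type := M q × M q

section
variable {q : ℕ} [NeZero q]

/-- The pairing `⟨(x,[n],[m]), (y,[k],[l])⟩ = e(xy) e(nk/q) e(ml/q)` of `M` with its dual. -/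
def pair (m s : M q) : ℂ :=
  e (m.1 * s.1) * ZMod.stdAddChar (m.2.1 * s.2.1) * ZMod.stdAddChar (m.2.2 * s.2.2)

/-- The Heisenberg cocycle `𝔥((m,s),(m',s')) = ⟨m,s'⟩`. -/
def cocyc (x y : G q) : ℂ := pair x.1 y.2

theorem e_add (s t : ℝ) : e (s + t) = e s * e t := by
  rw [e, e, e, ← Complex.exp_add]; congr 1; push_cast; ring

theorem norm_e (t : ℝ) : ‖e t‖ = 1 := by
  rw [e, Complex.norm_exp]; simp

theorem norm_pair (m s : M q) : ‖pair m s‖ = 1 := by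
  simp [pair, norm_e]

theorem pair_add_left (m m' s : M q) : pair (m + m') s = pair m s * pair m' s := by
  simp only [pair, Prod.fst_add, Prod.snd_add, add_mul, e_add, AddChar.map_add_eq_mul]; ring

theorem pair_add_right (m s s' : M q) : pair m (s + s') = pair m s * pair m s' := by
  simp only [pair, Prod.fst_add, Prod.snd_add, mul_add, e_add, AddChar.map_add_eq_mul]; ring

theorem pair_zero_left (s : M q) : pair (0 : M q) s = 1 := by
  simp [pair, e]

theorem pair_zero_right (m : M q) : pair m (0 : M q) = 1 := by
  simp [pair, e]

theorem measurable_pair (s : M q) : Measurable fun n : M q => pair n s := by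
  have h1 : Measurable fun n : M q => e (n.1 * s.1) := by
    unfold e; fun_prop
  have h2 : Measurable fun n : M q => (ZMod.stdAddChar (n.2.1 * s.2.1) : ℂ) :=
    (Measurable.of_discrete (f := fun k : ZMod q => (ZMod.stdAddChar (k * s.2.1) : ℂ))).comp
      (measurable_fst.comp measurable_snd)
  have h3 : Measurable fun n : M q => (ZMod.stdAddChar (n.2.2 * s.2.2) : ℂ) :=
    (Measurable.of_discrete (f := fun k : ZMod q => (ZMod.stdAddChar (k * s.2.2) : ℂ))).comp
      (measurable_snd.comp measurable_snd)
  exact (h1.mul h2).mul h3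

theorem measurePreserving_translate (m : M q) :
    MeasurePreserving (fun n : M q => n + m) (haarM q) (haarM q) :=
  ((measurePreserving_add_right (volume : Measure ℝ) m.1).prod
    ((measurePreserving_add_right (Measure.count : Measure (ZMod q)) m.2.1).prod
      (measurePreserving_add_right (Measure.count : Measure (ZMod q)) m.2.2))).smul_measure _

theorem heis_memLp (x : G q) (f : L2M q) :
    MemLp (fun n : M q => pair n x.2 * f (n + x.1)) 2 (haarM q) := by
  have h0 : MemLp (fun n : M q => f (n + x.1)) 2 (haarM q) :=
    (Lp.memLp f).comp_measurePreserving (measurePreserving_translate x.1)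
  refine h0.of_le ((measurable_pair x.2).aestronglyMeasurable.mul h0.1) ?_
  filter_upwards with n
  rw [norm_mul, norm_pair, one_mul]

/-- The Heisenberg operator `(π_{(m,s)} f)(n) = ⟨n,s⟩ f(n+m)`, as a linear isometry. -/
def heisIso (x : G q) : L2M q →ₗᵢ[ℂ] L2M q where
  toFun f := (heis_memLp x f).toLp _
  map_add' f g := by
    rw [← MemLp.toLp_add]
    refine MemLp.toLp_congr _ _ ?_
    filter_upwards [(measurePreserving_translate x.1).quasiMeasurePreserving.ae
      (Lp.coeFn_add f g)] with n hn
    simp only [Pi.add_apply] at hn ⊢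
    rw [hn, mul_add]
  map_smul' c f := by
    rw [RingHom.id_apply, ← MemLp.toLp_const_smul]
    refine MemLp.toLp_congr _ _ ?_
    filter_upwards [(measurePreserving_translate x.1).quasiMeasurePreserving.ae
      (Lp.coeFn_smul c f)] with n hn
    simp only [Pi.smul_apply, smul_eq_mul] at hn ⊢
    rw [hn]; ring
  norm_map' f := by
    change ‖(heis_memLp x f).toLp _‖ = ‖f‖
    rw [Lp.norm_toLp, Lp.norm_def]
    congr 1
    rw [← eLpNorm_comp_measurePreserving (Lp.aestronglyMeasurable f)
      (measurePreserving_translate x.1)]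
    refine eLpNorm_congr_norm_ae ?_
    filter_upwards with n
    simp [norm_pair]

theorem heisIso_apply (x : G q) (f : L2M q) :
    heisIso x f =ᵐ[haarM q] fun n => pair n x.2 * f (n + x.1) :=
  MemLp.coeFn_toLp (heis_memLp x f)

/-- `π_x π_y = 𝔥(x,y) π_{x+y}`. -/
theorem heisIso_mul (x y : G q) (f : L2M q) :
    heisIso x (heisIso y f) = cocyc x y • heisIso (x + y) f := by
  apply Lp.ext
  filter_upwards [heisIso_apply x (heisIso y f), heisIso_apply (x + y) f,
    Lp.coeFn_smul (cocyc x y) (heisIso (x + y) f),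
    (measurePreserving_translate x.1).quasiMeasurePreserving.ae (heisIso_apply y f)]
    with n h1 h2 h3 h4
  rw [h1, h3, Pi.smul_apply, h2, h4, smul_eq_mul, cocyc, Prod.snd_add, Prod.fst_add,
    pair_add_left, pair_add_right, add_assoc]
  ring

theorem heisIso_zero (f : L2M q) : heisIso (0 : G q) f = f := by
  apply Lp.ext
  filter_upwards [heisIso_apply (0 : G q) f] with n h1
  rw [h1, Prod.snd_zero, Prod.fst_zero, pair_zero_right, add_zero, one_mul]

theorem heisIso_surjective (x : G q) : Function.Surjective (heisIso x) := by
  intro f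
  have hne : cocyc x (-x) ≠ 0 := by
    rw [← norm_pos_iff, cocyc, norm_pair]; exact one_pos
  refine ⟨(cocyc x (-x))⁻¹ • heisIso (-x) f, ?_⟩
  rw [map_smul, heisIso_mul, add_neg_cancel, heisIso_zero, smul_smul, inv_mul_cancel₀ hne,
    one_smul]

/-- The Heisenberg operators `π_x`, as unitary operators on `L²(M)`. -/
def heis (x : G q) : unitary (L2M q →L[ℂ] L2M q) :=
  Unitary.linearIsometryEquiv.symm
    (LinearIsometryEquiv.ofSurjective (heisIso x) (heisIso_surjective x))

/-- The complementary lattice `D^⊥ = {y | 𝔥(x,y) conj(𝔥(y,x)) = 1 for all x ∈ D}`. -/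
def perp (D : AddSubgroup (G q)) : Set (G q) :=
  {y | ∀ x ∈ D, cocyc x y * (starRingEnd ℂ) (cocyc y x) = 1}

/-- `C*(D^⊥, conj 𝔥)`: the C*-algebra of bounded operators on `L²(M)` generated by the unitaries
`π_y^*`, `y ∈ D^⊥`. -/
def CstarPerp (D : AddSubgroup (G q)) : StarSubalgebra ℂ (L2M q →L[ℂ] L2M q) :=
  (StarAlgebra.adjoin ℂ
    {T | ∃ y ∈ perp D, T = star (heis y : L2M q →L[ℂ] L2M q)}).topologicalClosure

theorem star_heis_mem (D : AddSubgroup (G q)) {y : G q} (hy : y ∈ perp D) :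
    star (heis y : L2M q →L[ℂ] L2M q) ∈ CstarPerp D :=
  StarSubalgebra.le_topologicalClosure _ (StarAlgebra.subset_adjoin ℂ _ ⟨y, hy, rfl⟩)

/-- The unitary `π_y^*` of `C*(D^⊥, conj 𝔥)`, for `y ∈ D^⊥`. -/
def piStar (D : AddSubgroup (G q)) (y : G q) (hy : y ∈ perp D) : unitary (CstarPerp D) :=
  ⟨⟨star (heis y : L2M q →L[ℂ] L2M q), star_heis_mem D hy⟩, by
    rw [Unitary.mem_iff]
    constructor
    · apply Subtype.ext
      simp
    · apply Subtype.ext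
      simp⟩

theorem mem_perp_closure {S : Set (G q)} {y : G q}
    (hy : ∀ x ∈ S, cocyc x y * (starRingEnd ℂ) (cocyc y x) = 1) :
    y ∈ perp (AddSubgroup.closure S) := by
  intro x hx
  induction hx using AddSubgroup.closure_induction with
  | mem x hx => exact hy x hx
  | zero => simp [cocyc, pair_zero_left, pair_zero_right]
  | add x z _ _ ihx ihz =>
    have : cocyc (x + z) y * (starRingEnd ℂ) (cocyc y (x + z)) =
        (cocyc x y * (starRingEnd ℂ) (cocyc y x)) *
          (cocyc z y * (starRingEnd ℂ) (cocyc y z)) := by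
      simp only [cocyc, Prod.fst_add, Prod.snd_add, pair_add_left, pair_add_right, map_mul]; ring
    rw [this, ihx, ihz, one_mul]
  | neg x _ ihx =>
    have : (cocyc (-x) y * (starRingEnd ℂ) (cocyc y (-x))) *
        (cocyc x y * (starRingEnd ℂ) (cocyc y x)) = 1 := by
      have h1 : cocyc (-x) y * cocyc x y = 1 := by
        rw [cocyc, cocyc, ← pair_add_left, Prod.fst_neg, neg_add_cancel, pair_zero_left]
      have h2 : cocyc y (-x) * cocyc y x = 1 := by
        rw [cocyc, cocyc, ← pair_add_right, Prod.snd_neg, neg_add_cancel, pair_zero_right]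
      have h3 := congrArg (starRingEnd ℂ) h2
      rw [map_mul, map_one] at h3
      linear_combination (cocyc (-x) y * cocyc x y) * h3 + h1
    rwa [ihx, mul_one] at this

end

/-! ### The lattice and its parameters -/

/-- The data of the construction: a real number `θ`, a fraction `p/q` with `p = p'²` and
`0 < θ - p/q < q⁻³`, and an integer `p₀` with `p₀p' ≡ 1 (mod q)`. -/
structure Datum where
  θ : ℝ
  q : ℕ
  p' : ℕ
  p₀ : ℤ
  q_pos : 0 < q
  lt_theta : ((p' : ℝ) ^ 2) / q < θ
  close : θ - ((p' : ℝ) ^ 2) / q < 1 / (q : ℝ) ^ 3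
  inv : p₀ * (p' : ℤ) ≡ 1 [ZMOD (q : ℤ)]

namespace Datum

instance (d : Datum) : NeZero d.q := ⟨d.q_pos.ne'⟩

/-- `a = (θ - p/q)^(1/2)`. -/
def a (d : Datum) : ℝ := Real.sqrt (d.θ - ((d.p' : ℝ) ^ 2) / d.q)

/-- `β = 1/(qa)`. -/
def β (d : Datum) : ℝ := 1 / (d.q * d.a)

/-- The solution `α` of `β² = 4(α² + 1)`, positive when `β > 2`. -/
def α (d : Datum) : ℝ := Real.sqrt (d.β ^ 2 / 4 - 1)

/-- `ε₁ = (a, [p'], 0; 0, 0, 0)`. -/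
def ε₁ (d : Datum) : G d.q := ((d.a, (d.p' : ZMod d.q), 0), (0, 0, 0))

/-- `ε₂ = (0, 0, 0; a, [p'], 0)`. -/
def ε₂ (d : Datum) : G d.q := ((0, 0, 0), (d.a, (d.p' : ZMod d.q), 0))

/-- The lattice `D`, spanned by `ε₁` and `ε₂`. -/
def D (d : Datum) : AddSubgroup (G d.q) := AddSubgroup.closure {d.ε₁, d.ε₂}

/-- The C*-algebra `C*(D^⊥, conj 𝔥)`. -/
abbrev A (d : Datum) : Type := CstarPerp d.D

/-- `δ₁ = (β, [-p₀], 0; 0, 0, 0)`. -/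
def δ₁ (d : Datum) : G d.q := ((d.β, ((-d.p₀ : ℤ) : ZMod d.q), 0), (0, 0, 0))

/-- `δ₂ = (0, 0, 0; β, [-p₀], 0)`. -/
def δ₂ (d : Datum) : G d.q := ((0, 0, 0), (d.β, ((-d.p₀ : ℤ) : ZMod d.q), 0))

/-- `δ₃ = (0, 0, [1]; 0, 0, 0)`. -/
def δ₃ (d : Datum) : G d.q := ((0, 0, 1), (0, 0, 0))

/-- `δ₄ = (0, 0, 0; 0, 0, [1])`. -/
def δ₄ (d : Datum) : G d.q := ((0, 0, 0), (0, 0, 1))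

theorem a_pos (d : Datum) : 0 < d.a := Real.sqrt_pos.2 (sub_pos.2 d.lt_theta)

theorem a_mul_β (d : Datum) : d.a * d.β = 1 / d.q := by
  have h1 := d.a_pos.ne'
  have h2 : (d.q : ℝ) ≠ 0 := Nat.cast_ne_zero.2 d.q_pos.ne'
  rw [β]; field_simp

theorem p'_mul_p₀ (d : Datum) :
    (d.p' : ZMod d.q) * ((-d.p₀ : ℤ) : ZMod d.q) = ((-1 : ℤ) : ZMod d.q) := by
  have := (ZMod.intCast_eq_intCast_iff _ _ _).2 d.inv
  push_cast at this ⊢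
  linear_combination -this

theorem e_mul_char (d : Datum) :
    e (d.a * d.β) * ZMod.stdAddChar ((d.p' : ZMod d.q) * ((-d.p₀ : ℤ) : ZMod d.q)) = 1 := by
  rw [p'_mul_p₀, ZMod.stdAddChar_coe, a_mul_β, e, ← Complex.exp_add, Complex.exp_eq_one_iff]
  exact ⟨0, by push_cast; ring⟩

theorem δ₁_mem (d : Datum) : d.δ₁ ∈ perp d.D := by
  refine mem_perp_closure ?_
  rintro x (rfl | rfl)
  · simp [cocyc, pair, ε₁, δ₁, e]
  · have h1 := congrArg (starRingEnd ℂ) d.e_mul_char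
    rw [mul_comm d.a, mul_comm (d.p' : ZMod d.q)] at h1
    simpa [cocyc, pair, ε₂, δ₁, e] using h1

theorem δ₂_mem (d : Datum) : d.δ₂ ∈ perp d.D := by
  refine mem_perp_closure ?_
  rintro x (rfl | rfl)
  · have h1 := d.e_mul_char
    simpa [cocyc, pair, ε₁, δ₂, e] using h1
  · simp [cocyc, pair, ε₂, δ₂, e]

theorem δ₃_mem (d : Datum) : d.δ₃ ∈ perp d.D := by
  refine mem_perp_closure ?_
  rintro x (rfl | rfl) <;> simp [cocyc, pair, ε₁, ε₂, δ₃, e]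

theorem δ₄_mem (d : Datum) : d.δ₄ ∈ perp d.D := by
  refine mem_perp_closure ?_
  rintro x (rfl | rfl) <;> simp [cocyc, pair, ε₁, ε₂, δ₄, e]

/-- `V₁ = π_{δ₁}^*`. -/
def V₁ (d : Datum) : unitary d.A := piStar d.D d.δ₁ d.δ₁_mem

/-- `V₂ = π_{δ₂}^*`. -/
def V₂ (d : Datum) : unitary d.A := piStar d.D d.δ₂ d.δ₂_mem

/-- `V₃ = π_{δ₃}^*`. -/
def V₃ (d : Datum) : unitary d.A := piStar d.D d.δ₃ d.δ₃_mem

/-- `V₄ = π_{δ₄}^*`. -/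
def V₄ (d : Datum) : unitary d.A := piStar d.D d.δ₄ d.δ₄_mem

/-- `W₁ = V₁ V₃^(-p₀)`. -/
def W₁ (d : Datum) : unitary d.A := d.V₁ * d.V₃ ^ (-d.p₀)

/-- `W₂ = V₂ V₄^(p₀)`. -/
def W₂ (d : Datum) : unitary d.A := d.V₂ * d.V₄ ^ d.p₀

/-- The `(n₁,n₂)`-th term `√(2α) H(n₁β, n₂β) W₁^{n₁} W₂^{n₂}` of the series of `b`. -/
def bTerm (d : Datum) (n : ℤ × ℤ) : d.A :=
  ((Real.sqrt (2 * d.α) : ℂ) * H d.α d.β (n.1 * d.β) (n.2 * d.β)) •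
    ((d.W₁ ^ n.1 * d.W₂ ^ n.2 : unitary d.A) : d.A)

/-- `b = √(2α) ∑ H(n₁β, n₂β) W₁^{n₁} W₂^{n₂}`. -/
def b (d : Datum) : d.A := ∑' n : ℤ × ℤ, d.bTerm n

/-- The `m`-th term `exp(-πβ²m²/(2α)) Γ(m,0) W₂^m` of the series of `ψ₀(W₂)`. -/
def psi0Term (d : Datum) (m : ℤ) : d.A :=
  psiCoeff d.α d.β 0 m • ((d.W₂ ^ m : unitary d.A) : d.A)

/-- The element `ψ₀ = ψ₀(W₂)`: the function `ψ₀(t) = ∑ₘ exp(-πβ²m²/(2α)) Γ(m,0) e(mt)` with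
`e(t)` replaced by the unitary `W₂`. -/
def psi0 (d : Datum) : d.A := ∑' m : ℤ, d.psi0Term m

end Datum

end FourierProj

end

/-!
Put `κ = p - 1/2`. Up to the constant `exp(πα/4)`, the function `h` is the superposition over the
half-integers `κ` of the Gaussians `exp(-παx²)` with weight `exp(-πακ²)` and frequency `βκ/2`.
Integrating term by term (`hasSum_H`) turns `√(2α) H(n₁β, n₂β)` into a double series over
`(κ, κ')` whose terms have modulus
`exp(πα/2) exp(-παβ²n₁²/2) exp(-πα(κ²+κ'²)) exp(-πβ²(n₂+(κ'-κ)/2)²/(2α))`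
and are positive when `n₁ = 0`. Splitting the pairs by the parity of `κ' - κ`
(`hasSum_pairTerm`) and multiplying out the theta series in `Γ` (`psiCoeff_zero`) show that the row
`n₁ = 0` is exactly the series of `ψ₀`. With `rowCoeff α m ≥ 0` for the coefficients of `ψ₀`, the
`(n₁,n₂)`-th coefficient of `b` is therefore at most `exp(-παβ²n₁²/2) rowCoeff α n₂`.

Everything now rests on positive series. The sum `rowTotal α` of the `rowCoeff α m` is an explicit
combination of theta constants, because a shear of `ℤ × ℤ` separates the variables; it tends to `2`
as `α → ∞` (`tendsto_rowTotal`), and `rowCoeff α 0 ≥ 2` already. Hence `‖ψ₀ - 2‖` is at most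
`rowTotal α - 2`, and `‖b - ψ₀‖` is at most `rowTotal α` times the sum of `exp(-παβ²n₁²/2)` over
`n₁ ≠ 0`. Both tend to `0` uniformly, since `β² = 4(α²+1)` exceeds `q`.

For positivity, `b` is selfadjoint: `W₁ W₂ = e(β²) W₂ W₁` (`W₁_mul_W₂`), and the resulting phase in
`(W₁^n₁ W₂^n₂)^*` is cancelled by the one in `conj H(s,t) = e(st) H(-s,-t)` (`conj_H`). A
selfadjoint element within distance less than `2` of `2` is positive and invertible.
-/

noncomputable section

namespace FourierProj

/-! ### Gaussian sums over shifted integers -/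

/-- The Gaussian `exp(-πcx²)`. -/
def gauss (c x : ℝ) : ℝ := Real.exp (-(Real.pi * c * x ^ 2))

/-- The theta constant `∑ₙ exp(-πc(n+a)²)`, the sum being over the integers. -/
def gaussSum (c a : ℝ) : ℝ := ∑' n : ℤ, gauss c (n + a)

theorem gauss_pos (c x : ℝ) : 0 < gauss c x := Real.exp_pos _

theorem gauss_zero (c : ℝ) : gauss c 0 = 1 := by simp [gauss]

theorem gauss_le_one {c : ℝ} (hc : 0 ≤ c) (x : ℝ) : gauss c x ≤ 1 := by
  rw [gauss, Real.exp_le_one_iff]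
  have := Real.pi_pos
  have : 0 ≤ Real.pi * c * x ^ 2 := by positivity
  linarith

theorem summable_gauss {c : ℝ} (hc : 0 < c) (a : ℝ) :
    Summable fun n : ℤ => gauss c (n + a) := by
  refine (HurwitzZeta.hasSum_int_evenKernel a hc).summable.congr fun n => ?_
  rw [gauss]; congr 1; ring

theorem hasSum_gauss {c : ℝ} (hc : 0 < c) (a : ℝ) :
    HasSum (fun n : ℤ => gauss c (n + a)) (gaussSum c a) :=
  (summable_gauss hc a).hasSum

theorem gaussSum_nonneg (c a : ℝ) : 0 ≤ gaussSum c a :=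
  tsum_nonneg fun _ => (gauss_pos _ _).le

theorem exp_mul_gauss_half (c : ℝ) (n : ℤ) :
    Real.exp (Real.pi * c / 4) * gauss c (n + 1 / 2) =
      Real.exp (-(Real.pi * (n ^ 2 + n) * c)) := by
  rw [gauss, ← Real.exp_add]; congr 1; ring

/-- The terms `n = 0` and `n = -1` contribute `1` each. -/
theorem two_le_exp_mul_gaussSum_half {c : ℝ} (hc : 0 < c) :
    2 ≤ Real.exp (Real.pi * c / 4) * gaussSum c (1 / 2) := by
  have h1 := (summable_gauss hc (1 / 2)).mul_left (Real.exp (Real.pi * c / 4))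
  rw [gaussSum, ← tsum_mul_left]
  refine le_trans (le_of_eq ?_) (h1.sum_le_tsum {0, -1} fun n _ => ?_)
  · rw [Finset.sum_pair (by decide), exp_mul_gauss_half, exp_mul_gauss_half]
    norm_num
  · exact mul_nonneg (Real.exp_pos _).le (gauss_pos _ _).le

theorem tendsto_exp_neg_mul {k : ℝ} (hk : 0 < k) :
    Tendsto (fun c : ℝ => Real.exp (-(k * c))) atTop (𝓝 0) :=
  Real.tendsto_exp_neg_atTop_nhds_zero.comp (tendsto_id.const_mul_atTop hk)

theorem tendsto_gaussSum_zero : Tendsto (fun c => gaussSum c 0) atTop (𝓝 1) := by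
  have h := tendsto_tsum_of_dominated_convergence (𝓕 := atTop)
    (f := fun (c : ℝ) (n : ℤ) => gauss c (n + 0))
    (g := fun n : ℤ => if n = 0 then (1 : ℝ) else 0) (summable_gauss one_pos 0) ?_ ?_
  · simpa [gaussSum, tsum_ite_eq] using h
  · intro n
    by_cases hn : n = 0
    · simp [hn, gauss_zero]
    · have hk : 0 < Real.pi * (n : ℝ) ^ 2 := by
        have : (n : ℝ) ≠ 0 := Int.cast_ne_zero.2 hn
        positivity
      rw [if_neg hn]
      refine (tendsto_exp_neg_mul hk).congr fun c => ?_
      rw [gauss]; congr 1; ring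
  · filter_upwards [eventually_ge_atTop (1 : ℝ)] with c hc n
    rw [Real.norm_of_nonneg (gauss_pos _ _).le, gauss, gauss, Real.exp_le_exp]
    gcongr

/-- After multiplication by `exp(πc/4)`, only the terms `n = 0` and `n = -1` survive as `c → ∞`. -/
theorem tendsto_exp_mul_gaussSum_half :
    Tendsto (fun c => Real.exp (Real.pi * c / 4) * gaussSum c (1 / 2)) atTop (𝓝 2) := by
  have hn0 (n : ℤ) : 0 ≤ n ^ 2 + n := by
    rcases le_or_gt 0 n with h | h <;> nlinarith
  have h := tendsto_tsum_of_dominated_convergence (𝓕 := atTop)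
    (f := fun (c : ℝ) (n : ℤ) => Real.exp (Real.pi * c / 4) * gauss c (n + 1 / 2))
    (g := fun n : ℤ => if n ∈ ({0, -1} : Finset ℤ) then (1 : ℝ) else 0)
    ((summable_gauss one_pos (1 / 2)).mul_left (Real.exp (Real.pi * 1 / 4))) ?_ ?_
  · simp only [tsum_mul_left] at h
    have h2 : (∑' n : ℤ, if n ∈ ({0, -1} : Finset ℤ) then (1 : ℝ) else 0) = 2 := by
      rw [tsum_eq_sum (s := {0, -1}) fun n hn => if_neg hn,
        Finset.sum_pair (by decide)]
      norm_num
    rw [h2] at h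
    exact h
  · intro n
    simp only [exp_mul_gauss_half]
    by_cases hn : n ∈ ({0, -1} : Finset ℤ)
    · rw [if_pos hn]
      have : (n : ℝ) ^ 2 + n = 0 := by
        simp only [Finset.mem_insert, Finset.mem_singleton] at hn
        rcases hn with rfl | rfl <;> norm_num
      simp [this]
    · rw [if_neg hn]
      refine tendsto_exp_neg_mul (mul_pos Real.pi_pos ?_)
      have h1 : n ^ 2 + n ≠ 0 := by
        intro h0
        have : n * (n + 1) = 0 := by linear_combination h0
        simp only [Finset.mem_insert, Finset.mem_singleton] at hn
        rcases mul_eq_zero.1 this with h | h <;> omega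
      exact_mod_cast lt_of_le_of_ne (hn0 n) (Ne.symm h1)
  · filter_upwards [eventually_ge_atTop (1 : ℝ)] with c hc n
    rw [exp_mul_gauss_half, exp_mul_gauss_half, Real.norm_of_nonneg (Real.exp_pos _).le,
      Real.exp_le_exp]
    have : (0 : ℝ) ≤ (n : ℝ) ^ 2 + n := by exact_mod_cast hn0 n
    have hp := Real.pi_pos
    gcongr

theorem tendsto_gaussSum_half : Tendsto (fun c => gaussSum c (1 / 2)) atTop (𝓝 0) := by
  have h := (tendsto_exp_neg_mul (k := Real.pi / 4) (by positivity)).mul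
    tendsto_exp_mul_gaussSum_half
  rw [zero_mul] at h
  refine h.congr fun c => ?_
  rw [← mul_assoc, ← Real.exp_add, show -(Real.pi / 4 * c) + Real.pi * c / 4 = 0 by ring,
    Real.exp_zero, one_mul]

/-! ### The coefficients of `ψ₀` as sums of positive reals -/

/-- The correlation `∑ₙ exp(-πc(m+n+a)²) exp(-πd(n+a)²)` of two Gaussians over `ℤ + a`. -/
def overlap (c d a : ℝ) (m : ℤ) : ℝ :=
  ∑' n : ℤ, gauss c (m + (n + a)) * gauss d (n + a)

theorem hasSum_overlap {c d : ℝ} (hc : 0 < c) (hd : 0 < d) (a : ℝ) (m : ℤ) :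
    HasSum (fun n : ℤ => gauss c (m + (n + a)) * gauss d (n + a)) (overlap c d a m) := by
  refine (Summable.of_nonneg_of_le (fun n => ?_) (fun n => ?_) (summable_gauss hd a)).hasSum
  · exact mul_nonneg (gauss_pos _ _).le (gauss_pos _ _).le
  · exact mul_le_of_le_one_left (gauss_pos _ _).le (gauss_le_one hc.le _)

theorem overlap_nonneg (c d a : ℝ) (m : ℤ) : 0 ≤ overlap c d a m :=
  tsum_nonneg fun _ => mul_nonneg (gauss_pos _ _).le (gauss_pos _ _).le

theorem one_le_overlap {c d : ℝ} (hc : 0 < c) (hd : 0 < d) : 1 ≤ overlap c d 0 0 := by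
  refine le_trans (le_of_eq ?_) ((hasSum_overlap hc hd 0 0).summable.le_tsum 0 fun _ _ =>
    mul_nonneg (gauss_pos _ _).le (gauss_pos _ _).le)
  simp [gauss_zero]

/-- Shearing `(m,n) ↦ (m+n,n)` separates the variables. -/
theorem hasSum_overlap_sum {c d : ℝ} (hc : 0 < c) (hd : 0 < d) (a : ℝ) :
    HasSum (overlap c d a) (gaussSum c a * gaussSum d a) := by
  have h1 := (hasSum_gauss hc a).mul (hasSum_gauss hd a)
    ((summable_gauss hc a).mul_of_nonneg (summable_gauss hd a)
      (fun _ => (gauss_pos _ _).le) (fun _ => (gauss_pos _ _).le))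
  let shear : ℤ × ℤ ≃ ℤ × ℤ :=
    { toFun := fun x => (x.1 + x.2, x.2)
      invFun := fun x => (x.1 - x.2, x.2)
      left_inv := fun x => by simp
      right_inv := fun x => by simp }
  refine ((shear.hasSum_iff).2 h1).prod_fiberwise fun m => ?_
  refine (hasSum_overlap hc hd a m).congr_fun fun n => ?_
  simp only [shear, Function.comp, Equiv.coe_fn_mk, Int.cast_add]
  ring_nf

/-- The value of the `m`-th Fourier coefficient `exp(-πβ²m²/(2α)) Γ(m,0)` of `ψ₀`, written with
positive terms; here `β²/(2α) = 2(α+1/α)`. -/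
def rowCoeff (α : ℝ) (m : ℤ) : ℝ :=
  Real.exp (Real.pi * α / 2) *
    (gaussSum (2 * α) (1 / 2) * overlap (2 * (α + 1 / α)) (2 * α) 0 m +
      gaussSum (2 * α) 0 * overlap (2 * (α + 1 / α)) (2 * α) (1 / 2) m)

/-- The sum over `m` of the coefficients `rowCoeff α m`. -/
def rowTotal (α : ℝ) : ℝ :=
  Real.exp (Real.pi * α / 2) *
    (gaussSum (2 * α) (1 / 2) *
        (gaussSum (2 * (α + 1 / α)) 0 * gaussSum (2 * α) 0) +
      gaussSum (2 * α) 0 *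
        (gaussSum (2 * (α + 1 / α)) (1 / 2) * gaussSum (2 * α) (1 / 2)))

theorem hasSum_rowCoeff {α : ℝ} (hα : 0 < α) : HasSum (rowCoeff α) (rowTotal α) :=
  (((hasSum_overlap_sum (by positivity) (by positivity) 0).mul_left _).add
    ((hasSum_overlap_sum (by positivity) (by positivity) (1 / 2)).mul_left _)).mul_left _

theorem rowCoeff_nonneg (α : ℝ) (m : ℤ) : 0 ≤ rowCoeff α m :=
  mul_nonneg (Real.exp_pos _).le (add_nonneg
    (mul_nonneg (gaussSum_nonneg _ _) (overlap_nonneg _ _ _ _))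
    (mul_nonneg (gaussSum_nonneg _ _) (overlap_nonneg _ _ _ _)))

theorem two_le_rowCoeff {α : ℝ} (hα : 0 < α) : 2 ≤ rowCoeff α 0 := by
  have h1 := two_le_exp_mul_gaussSum_half (c := 2 * α) (by positivity)
  rw [show Real.pi * (2 * α) / 4 = Real.pi * α / 2 by ring] at h1
  have h2 := one_le_overlap (c := 2 * (α + 1 / α)) (d := 2 * α) (by positivity) (by positivity)
  have h3 := mul_nonneg (gaussSum_nonneg (2 * α) 0)
    (overlap_nonneg (2 * (α + 1 / α)) (2 * α) (1 / 2) 0)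
  have h4 := Real.exp_pos (Real.pi * α / 2)
  rw [rowCoeff, mul_add, ← mul_assoc]
  nlinarith [mul_nonneg h4.le h3]

theorem tendsto_rowTotal : Tendsto rowTotal atTop (𝓝 2) := by
  have hα : Tendsto (fun α : ℝ => 2 * α) atTop atTop := tendsto_id.const_mul_atTop two_pos
  have hγ : Tendsto (fun α : ℝ => 2 * (α + 1 / α)) atTop atTop := by
    refine tendsto_atTop_mono' _ ?_ hα
    filter_upwards [eventually_gt_atTop (0 : ℝ)] with α h
    have : 0 < 1 / α := by positivity
    linarith
  have h1 := tendsto_exp_mul_gaussSum_half.comp hα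
  have h2 := tendsto_gaussSum_zero.comp hα
  have h3 := tendsto_gaussSum_zero.comp hγ
  have h4 := tendsto_gaussSum_half.comp hγ
  have h := (h1.mul (h3.mul h2)).add (h1.mul (h2.mul h4))
  norm_num only at h
  refine h.congr fun α => ?_
  simp only [Function.comp, rowTotal, show Real.pi * (2 * α) / 4 = Real.pi * α / 2 by ring]
  ring

theorem theta2_zero (α : ℝ) :
    theta2 0 (2 * Complex.I * α) = (gaussSum (2 * α) (1 / 2) : ℂ) := by
  rw [theta2, gaussSum, Complex.ofReal_tsum]
  refine tsum_congr fun n => ?_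
  rw [gauss, Complex.ofReal_exp, ← Complex.exp_add]
  congr 1; push_cast
  linear_combination (2 * Real.pi * α * ((n : ℂ) + 1 / 2) ^ 2) * Complex.I_sq

theorem theta3_zero (α : ℝ) :
    theta3 0 (2 * Complex.I * α) = (gaussSum (2 * α) 0 : ℂ) := by
  rw [theta3, gaussSum, Complex.ofReal_tsum]
  refine tsum_congr fun n => ?_
  rw [gauss, Complex.ofReal_exp, ← Complex.exp_add]
  congr 1; push_cast
  linear_combination (2 * Real.pi * α * (n : ℂ) ^ 2) * Complex.I_sq

/-- Completing the square in the exponents of `ϑ₃` at an imaginary argument. -/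
theorem gauss_mul_theta3 {α β : ℝ} (hα : 0 < α) (hβ : β ^ 2 = 4 * (α ^ 2 + 1)) (m : ℤ) :
    (Real.exp (-Real.pi * β ^ 2 * (m : ℝ) ^ 2 / (2 * α)) : ℂ) *
      theta3 (Complex.I * ((Real.pi / (2 * α) * β ^ 2 * m : ℝ) : ℂ))
        (Complex.I * ((4 * α + 2 / α : ℝ) : ℂ)) =
      (overlap (2 * (α + 1 / α)) (2 * α) 0 m : ℂ) := by
  have hα' : (α : ℂ) ≠ 0 := Complex.ofReal_ne_zero.2 hα.ne'
  have hβ' : (β : ℂ) ^ 2 = 4 * (α ^ 2 + 1) := by exact_mod_cast hβ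
  rw [theta3, ← tsum_mul_left, overlap, Complex.ofReal_tsum]
  refine tsum_congr fun n => ?_
  rw [gauss, gauss, ← Real.exp_add, Complex.ofReal_exp, Complex.ofReal_exp, ← Complex.exp_add,
    ← Complex.exp_add]
  congr 1; push_cast; rw [hβ']; field_simp
  linear_combination
    (8 * m * n * (α ^ 2 + 1) + n ^ 2 * (8 * α ^ 2 + 4) : ℂ) * Complex.I_sq

theorem gauss_mul_theta2 {α β : ℝ} (hα : 0 < α) (hβ : β ^ 2 = 4 * (α ^ 2 + 1)) (m : ℤ) :
    (Real.exp (-Real.pi * β ^ 2 * (m : ℝ) ^ 2 / (2 * α)) : ℂ) *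
      theta2 (Complex.I * ((Real.pi / (2 * α) * β ^ 2 * m : ℝ) : ℂ))
        (Complex.I * ((4 * α + 2 / α : ℝ) : ℂ)) =
      (overlap (2 * (α + 1 / α)) (2 * α) (1 / 2) m : ℂ) := by
  have hα' : (α : ℂ) ≠ 0 := Complex.ofReal_ne_zero.2 hα.ne'
  have hβ' : (β : ℂ) ^ 2 = 4 * (α ^ 2 + 1) := by exact_mod_cast hβ
  rw [theta2, ← tsum_mul_left, overlap, Complex.ofReal_tsum]
  refine tsum_congr fun n => ?_
  rw [gauss, gauss, ← Real.exp_add, Complex.ofReal_exp, Complex.ofReal_exp, ← Complex.exp_add,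
    ← Complex.exp_add]
  congr 1; push_cast; rw [hβ']; generalize (n : ℂ) + 1 / 2 = k; field_simp
  linear_combination
    (8 * m * k * (α ^ 2 + 1) + k ^ 2 * (8 * α ^ 2 + 4) : ℂ) * Complex.I_sq

theorem psiCoeff_zero {α β : ℝ} (hα : 0 < α) (hβ : β ^ 2 = 4 * (α ^ 2 + 1)) (m : ℤ) :
    psiCoeff α β 0 m = (rowCoeff α m : ℂ) := by
  have h3 := gauss_mul_theta3 hα hβ m
  have h2 := gauss_mul_theta2 hα hβ m
  have h1 : e (β ^ 2 * m * (0 : ℤ) / 2) = 1 := by simp [e]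
  rw [psiCoeff, h1, Gam, rowCoeff]
  simp only [Int.cast_zero, mul_zero, Complex.ofReal_zero, theta2_zero, theta3_zero,
    Complex.ofReal_mul, Complex.ofReal_add]
  rw [← h2, ← h3]
  push_cast
  ring

/-! ### The series for `H` -/

/-- The `(p,p')`-th contribution to `√(2α) H(0,mβ)`. -/
def pairTerm (α β : ℝ) (m : ℤ) (p : ℤ × ℤ) : ℝ :=
  Real.exp (-(Real.pi * β ^ 2 * (m + ((p.2 : ℝ) - p.1) / 2) ^ 2 / (2 * α)) -
    Real.pi * α * ((p.1 : ℝ) ^ 2 - p.1 + (p.2 : ℝ) ^ 2 - p.2))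

/-- Pairs of integers, split by the parity of the difference: `inl (k,n)` is the pair
`(k+1-n, k+1+n)`, and `inr (k,n)` the pair `(k-n, k+n+1)`. -/
def parityEquiv : (ℤ × ℤ) ⊕ (ℤ × ℤ) ≃ ℤ × ℤ :=
  Equiv.ofBijective
    (Sum.elim (fun x => (x.1 + 1 - x.2, x.1 + 1 + x.2)) fun x => (x.1 - x.2, x.1 + x.2 + 1)) (by
      constructor
      · rintro (⟨k, n⟩ | ⟨k, n⟩) (⟨k', n'⟩ | ⟨k', n'⟩) h <;>
          simp only [Sum.elim_inl, Sum.elim_inr, Prod.mk.injEq, Sum.inl.injEq, Sum.inr.injEq,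
            reduceCtorEq] at h ⊢ <;> omega
      · rintro ⟨p, p'⟩
        rcases Int.emod_two_eq_zero_or_one (p' - p) with h | h
        · refine ⟨Sum.inl ((p + p') / 2 - 1, (p' - p) / 2), ?_⟩
          simp only [Sum.elim_inl, Prod.mk.injEq]; omega
        · refine ⟨Sum.inr ((p + p' - 1) / 2, (p' - p - 1) / 2), ?_⟩
          simp only [Sum.elim_inr, Prod.mk.injEq]; omega)

theorem parityEquiv_inl (k n : ℤ) : parityEquiv (Sum.inl (k, n)) = (k + 1 - n, k + 1 + n) := rfl

theorem parityEquiv_inr (k n : ℤ) : parityEquiv (Sum.inr (k, n)) = (k - n, k + n + 1) := rfl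

/-- On pairs of one parity the double series is a product of a sum over `k` and a correlation
sum over `n`. -/
theorem hasSum_pairTerm {α β : ℝ} (hα : 0 < α) (hβ : β ^ 2 = 4 * (α ^ 2 + 1)) (m : ℤ) :
    HasSum (pairTerm α β m) (rowCoeff α m) := by
  have h2α : 0 < 2 * α := by positivity
  have hγ : 0 < 2 * (α + 1 / α) := by positivity
  have key (a a' : ℝ) :
      HasSum (fun x : ℤ × ℤ => Real.exp (Real.pi * α / 2) * (gauss (2 * α) (x.1 + a') *
        (gauss (2 * (α + 1 / α)) (m + (x.2 + a)) * gauss (2 * α) (x.2 + a))))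
      (Real.exp (Real.pi * α / 2) *
        (gaussSum (2 * α) a' * overlap (2 * (α + 1 / α)) (2 * α) a m)) := by
    have h := hasSum_overlap hγ h2α a m
    exact ((hasSum_gauss h2α a').mul h ((summable_gauss h2α a').mul_of_nonneg h.summable
      (fun _ => (gauss_pos _ _).le)
      (fun _ => mul_nonneg (gauss_pos _ _).le (gauss_pos _ _).le))).mul_left _
  rw [← parityEquiv.hasSum_iff, rowCoeff, mul_add]
  refine HasSum.sum ((key 0 (1 / 2)).congr_fun ?_) ((key (1 / 2) 0).congr_fun ?_)
  · rintro ⟨k, n⟩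
    simp only [Function.comp, parityEquiv_inl, pairTerm, gauss,
      ← Real.exp_add, hβ]
    congr 1; push_cast; field_simp; ring
  · rintro ⟨k, n⟩
    simp only [Function.comp, parityEquiv_inr, pairTerm, gauss,
      ← Real.exp_add, hβ]
    congr 1; push_cast; field_simp; ring

/-- The exponential weight `exp(-παp²+παp)` of the `p`-th term of `h`. -/
def weight (α : ℝ) (p : ℤ) : ℝ := Real.exp (-Real.pi * α * ((p : ℝ) ^ 2 - p))

theorem summable_weight {α : ℝ} (hα : 0 < α) : Summable (weight α) := by
  refine ((summable_gauss hα (-1 / 2)).mul_left (Real.exp (Real.pi * α / 4))).congr fun p => ?_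
  rw [gauss, weight, ← Real.exp_add]; congr 1; ring

theorem weight_pos (α : ℝ) (p : ℤ) : 0 < weight α p := Real.exp_pos _

/-- The `p`-th term of `h`, including the Gaussian factor. -/
def hTerm (α β : ℝ) (p : ℤ) (x : ℝ) : ℂ :=
  (weight α p : ℂ) *
    Complex.exp (-Real.pi * α * x ^ 2 + Real.pi * β * (p - 1 / 2) * x * Complex.I)

theorem norm_hTerm (α β : ℝ) (p : ℤ) (x : ℝ) : ‖hTerm α β p x‖ = weight α p * gauss α x := by
  have h1 : -Real.pi * α * x ^ 2 + Real.pi * β * (p - 1 / 2) * x * Complex.I =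
      ((-(Real.pi * α * x ^ 2) : ℝ) : ℂ) +
        ((Real.pi * β * (p - 1 / 2) * x : ℝ) : ℂ) * Complex.I := by
    push_cast; ring
  rw [hTerm, norm_mul, Complex.norm_real, Real.norm_of_nonneg (weight_pos α p).le, h1,
    Complex.norm_exp, gauss, Complex.add_re, Complex.ofReal_re, Complex.re_ofReal_mul,
    Complex.I_re, mul_zero, add_zero]

theorem summable_norm_hTerm {α : ℝ} (hα : 0 < α) (β x : ℝ) :
    Summable fun p => ‖hTerm α β p x‖ :=
  ((summable_weight hα).mul_right (gauss α x)).congr fun p => (norm_hTerm α β p x).symm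

theorem hasSum_hTerm {α : ℝ} (hα : 0 < α) (β x : ℝ) :
    HasSum (fun p => hTerm α β p x) (h α β x) := by
  have h1 : h α β x = ∑' p, hTerm α β p x := by
    rw [h, ← tsum_mul_left]
    refine tsum_congr fun p => ?_
    rw [hTerm, weight, e]
    simp only [Complex.ofReal_exp, ← Complex.exp_add]
    congr 1; push_cast; ring
  rw [h1]
  exact (summable_norm_hTerm hα β x).of_norm.hasSum

/-- The `(p,p')`-th term of the integrand of `H`. -/
def integrandTerm (α β s t : ℝ) (p : ℤ × ℤ) (x : ℝ) : ℂ :=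
  Complex.exp (((-(2 * Real.pi * α) : ℝ) : ℂ) * x ^ 2 +
    (-(2 * Real.pi * α * s) + Real.pi * (β * (p.2 - p.1) + 2 * t) * Complex.I) * x +
    (-(Real.pi * α * s ^ 2) + Real.pi * β * (p.2 - 1 / 2) * s * Complex.I -
      Real.pi * α * ((p.1 : ℂ) ^ 2 - p.1 + (p.2 : ℂ) ^ 2 - p.2)))

theorem integrandTerm_eq (α β s t : ℝ) (p : ℤ × ℤ) (x : ℝ) :
    integrandTerm α β s t p x =
      (starRingEnd ℂ) (hTerm α β p.1 x) * hTerm α β p.2 (x + s) * e (x * t) := by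
  rw [integrandTerm, hTerm, hTerm, map_mul, Complex.conj_ofReal, ← Complex.exp_conj, weight,
    weight, e]
  simp only [Complex.ofReal_exp, ← Complex.exp_add]
  congr 1
  simp only [map_add, map_mul, map_neg, map_sub, map_pow, map_div₀, Complex.conj_ofReal,
    Complex.conj_I, map_one, map_ofNat, map_intCast]
  push_cast; ring

theorem norm_integrandTerm (α β s t : ℝ) (p : ℤ × ℤ) (x : ℝ) :
    ‖integrandTerm α β s t p x‖ =
      weight α p.1 * weight α p.2 * (gauss α x * gauss α (x + s)) := by
  rw [integrandTerm_eq, norm_mul, norm_mul, RCLike.norm_conj, norm_hTerm, norm_hTerm, norm_e]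
  ring

theorem hasSum_integrand {α : ℝ} (hα : 0 < α) (β s t x : ℝ) :
    HasSum (fun p => integrandTerm α β s t p x)
      ((starRingEnd ℂ) (h α β x) * h α β (x + s) * e (x * t)) := by
  simp only [integrandTerm_eq]
  have h1 : HasSum (fun p => (starRingEnd ℂ) (hTerm α β p x)) ((starRingEnd ℂ) (h α β x)) :=
    Complex.hasSum_conj'.2 (hasSum_hTerm hα β x)
  have h2 : Summable fun p => ‖(starRingEnd ℂ) (hTerm α β p x)‖ := by
    simpa only [RCLike.norm_conj] using summable_norm_hTerm hα β x
  have h3 := summable_mul_of_summable_norm h2 (summable_norm_hTerm hα β (x + s))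
  have h4 := h1.mul (hasSum_hTerm hα β (x + s)) h3
  exact h4.mul_right _

/-- The exponent left by the Gaussian integral of `integrandTerm`. -/
def coeffExponent (α β s t : ℝ) (p : ℤ × ℤ) : ℂ :=
  (-(Real.pi * α * s ^ 2) + Real.pi * β * (p.2 - 1 / 2) * s * Complex.I -
      Real.pi * α * ((p.1 : ℂ) ^ 2 - p.1 + (p.2 : ℂ) ^ 2 - p.2)) -
    (-(2 * Real.pi * α * s) + Real.pi * (β * (p.2 - p.1) + 2 * t) * Complex.I) ^ 2 /
      (4 * ((-(2 * Real.pi * α) : ℝ) : ℂ))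

/-- Termwise integration of the Gaussians; the factor `√(2α)` normalizes the Gaussian integral. -/
theorem hasSum_H {α : ℝ} (hα : 0 < α) (β s t : ℝ) :
    HasSum (fun p => Complex.exp (coeffExponent α β s t p))
      ((Real.sqrt (2 * α) : ℂ) * H α β s t) := by
  have hb : ((-(2 * Real.pi * α) : ℝ) : ℂ).re < 0 := by
    rw [Complex.ofReal_re]; have := Real.pi_pos; have : 0 < 2 * Real.pi * α := by positivity
    linarith
  have hint (p : ℤ × ℤ) : Integrable (integrandTerm α β s t p) := by
    have := integrable_cexp_quadratic (b := -((-(2 * Real.pi * α) : ℝ) : ℂ))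
      (by rw [Complex.neg_re]; linarith)
      (-(2 * Real.pi * α * s) + Real.pi * (β * (p.2 - p.1) + 2 * t) * Complex.I)
      (-(Real.pi * α * s ^ 2) + Real.pi * β * (p.2 - 1 / 2) * s * Complex.I -
        Real.pi * α * ((p.1 : ℂ) ^ 2 - p.1 + (p.2 : ℂ) ^ 2 - p.2))
    simp only [neg_neg] at this
    exact this
  have hw := (summable_weight hα).mul_of_nonneg (summable_weight hα)
    (fun _ => (Real.exp_pos _).le) (fun _ => (Real.exp_pos _).le)
  have h1 := hasSum_integral_of_summable_integral_norm hint (by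
    simp only [norm_integrandTerm, integral_const_mul]
    exact hw.mul_right _)
  have h2 := h1.mul_left (Real.sqrt (2 * α) : ℂ)
  simp only [(hasSum_integrand hα β s t _).tsum_eq] at h2
  refine h2.congr_fun fun p => ?_
  simp only [integrandTerm]
  rw [integral_cexp_quadratic hb, ← mul_assoc]
  have h3 : (Real.sqrt (2 * α) : ℂ) *
      ((Real.pi : ℂ) / -((-(2 * Real.pi * α) : ℝ) : ℂ)) ^ (1 / 2 : ℂ) = 1 := by
    have h4 : (Real.pi : ℂ) / -((-(2 * Real.pi * α) : ℝ) : ℂ) = (((2 * α)⁻¹ : ℝ) : ℂ) := by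
      rw [← Complex.ofReal_neg, ← Complex.ofReal_div]
      congr 1
      have := Real.pi_pos.ne'
      field_simp
    rw [h4, show (1 / 2 : ℂ) = ((1 / 2 : ℝ) : ℂ) by norm_num,
      ← Complex.ofReal_cpow (by positivity), ← Real.sqrt_eq_rpow, ← Complex.ofReal_mul,
      Real.sqrt_inv, mul_inv_cancel₀ (by positivity), Complex.ofReal_one]
  rw [h3, one_mul, coeffExponent]

/-- Up to a phase, the exponent separates into the factor in `n` and the term with `n = 0`. -/
theorem norm_exp_coeffExponent {α : ℝ} (hα : 0 < α) (β : ℝ) (n m : ℤ) (p : ℤ × ℤ) :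
    ‖Complex.exp (coeffExponent α β (n * β) (m * β) p)‖ =
      gauss (α * β ^ 2 / 2) n * pairTerm α β m p := by
  rw [Complex.norm_exp, gauss, pairTerm, ← Real.exp_add]
  congr 1
  have h : coeffExponent α β (n * β) (m * β) p =
      ((-(Real.pi * (α * β ^ 2 / 2) * n ^ 2) +
        (-(Real.pi * β ^ 2 * (m + ((p.2 : ℝ) - p.1) / 2) ^ 2 / (2 * α)) -
          Real.pi * α * ((p.1 : ℝ) ^ 2 - p.1 + (p.2 : ℝ) ^ 2 - p.2)) : ℝ) : ℂ) +
      ((Real.pi * β * (p.2 - 1 / 2) * (n * β) -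
        Real.pi * (n * β) * (β * (p.2 - p.1) + 2 * (m * β)) / 2 : ℝ) : ℂ) * Complex.I := by
    have h1 : (α : ℂ) ≠ 0 := Complex.ofReal_ne_zero.2 hα.ne'
    have h2 : (Real.pi : ℂ) ≠ 0 := Complex.ofReal_ne_zero.2 Real.pi_pos.ne'
    rw [coeffExponent]; push_cast
    field_simp
    ring_nf
    simp only [Complex.I_sq]
    ring
  rw [h, Complex.add_re, Complex.ofReal_re, Complex.re_ofReal_mul, Complex.I_re, mul_zero,
    add_zero]

theorem exp_coeffExponent_zero {α : ℝ} (hα : 0 < α) (β : ℝ) (m : ℤ) (p : ℤ × ℤ) :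
    Complex.exp (coeffExponent α β 0 (m * β) p) = (pairTerm α β m p : ℂ) := by
  rw [pairTerm, Complex.ofReal_exp]
  congr 1
  have h1 : (α : ℂ) ≠ 0 := Complex.ofReal_ne_zero.2 hα.ne'
  have h2 : (Real.pi : ℂ) ≠ 0 := Complex.ofReal_ne_zero.2 Real.pi_pos.ne'
  rw [coeffExponent]; push_cast
  field_simp
  ring_nf
  simp only [Complex.I_sq]
  ring

theorem norm_H_le {α β : ℝ} (hα : 0 < α) (hβ : β ^ 2 = 4 * (α ^ 2 + 1)) (n m : ℤ) :
    ‖(Real.sqrt (2 * α) : ℂ) * H α β (n * β) (m * β)‖ ≤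
      gauss (α * β ^ 2 / 2) n * rowCoeff α m := by
  rw [← (hasSum_H hα β (n * β) (m * β)).tsum_eq]
  refine tsum_of_norm_bounded ((hasSum_pairTerm hα hβ m).mul_left _) fun p => ?_
  exact (norm_exp_coeffExponent hα β n m p).le

theorem H_zero {α β : ℝ} (hα : 0 < α) (hβ : β ^ 2 = 4 * (α ^ 2 + 1)) (m : ℤ) :
    (Real.sqrt (2 * α) : ℂ) * H α β 0 (m * β) = (rowCoeff α m : ℂ) := by
  have h := hasSum_H hα β 0 (m * β)
  simp only [exp_coeffExponent_zero hα] at h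
  exact h.unique (Complex.hasSum_ofReal.2 (hasSum_pairTerm hα hβ m))

/-- Translating the integration variable by `s` gives the adjoint symmetry of `H`. -/
theorem conj_H (α β s t : ℝ) :
    (starRingEnd ℂ) (H α β s t) = e (s * t) * H α β (-s) (-t) := by
  rw [H, H, ← integral_conj, ← integral_const_mul]
  symm
  rw [← integral_add_right_eq_self _ s]
  refine integral_congr_ae (Eventually.of_forall fun x => ?_)
  have h1 : (starRingEnd ℂ) (e (x * t)) = e (s * t) * e ((x + s) * -t) := by
    rw [← e_add, e, e, ← Complex.exp_conj]
    congr 1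
    simp only [map_mul, map_ofNat, Complex.conj_ofReal, Complex.conj_I]
    push_cast; ring
  simp only [map_mul, Complex.conj_conj, h1, add_neg_cancel_right]
  ring

/-! ### The commutation relation of `W₁` and `W₂` -/

theorem heis_mul {q : ℕ} [NeZero q] (x y : G q) :
    (heis x : L2M q →L[ℂ] L2M q) * heis y = cocyc x y • (heis (x + y) : L2M q →L[ℂ] L2M q) := by
  ext1 f
  exact heisIso_mul x y f

/-- Powers of two group elements that commute up to a central element. -/
theorem zpow_mul_zpow_of_mul_eq {U : Type*} [Group U] {u v z : U} (huz : Commute u z)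
    (hvz : Commute v z) (h : u * v = z * (v * u)) (m n : ℤ) :
    u ^ m * v ^ n = z ^ (m * n) * (v ^ n * u ^ m) := by
  have h1 : SemiconjBy u v (z * v) := by rw [SemiconjBy, h, mul_assoc]
  have h2 := h1.zpow_right n
  rw [hvz.symm.mul_zpow] at h2
  -- The relation is linear in each exponent: conjugating `u` by `v ^ n` handles the power `m`.
  have h3 : SemiconjBy (v ^ n)⁻¹ u (z ^ n * u) := by
    rw [SemiconjBy, inv_mul_eq_iff_eq_mul, mul_assoc, ← mul_assoc, ← mul_assoc,
      ((hvz.zpow_left n).zpow_right n).eq, ← h2.eq, mul_assoc]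
    simp
  have h4 := h3.zpow_right m
  rw [(huz.symm.zpow_left n).mul_zpow, ← zpow_mul, mul_comm n m, SemiconjBy,
    inv_mul_eq_iff_eq_mul, mul_assoc, ← mul_assoc, ← mul_assoc,
    ((hvz.zpow_left n).zpow_right (m * n)).eq] at h4
  simpa [mul_assoc] using congrArg (· * v ^ n) h4

theorem mul_mul_swap {U : Type*} [Semigroup U] {a b c d z w : U} (hab : a * b = z * (b * a))
    (hcd : c * d = w * (d * c)) (had : Commute a d) (hbc : Commute b c) (haw : Commute a w)
    (hbw : Commute b w) : a * c * (b * d) = z * w * (b * d * (a * c)) := by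
  calc a * c * (b * d) = a * b * (c * d) := by
        rw [mul_assoc, ← mul_assoc c, ← hbc.eq, mul_assoc b, mul_assoc a]
    _ = z * (b * a * w) * (d * c) := by rw [hab, hcd]; simp only [mul_assoc]
    _ = z * w * (b * (a * d) * c) := by
        rw [(hbw.mul_left haw).eq]; simp only [mul_assoc]
    _ = _ := by rw [had.eq]; simp only [mul_assoc]

/-- The scalar unitaries of `C*(D^⊥, conj 𝔥)`. -/
def phase {q : ℕ} [NeZero q] (D : AddSubgroup (G q)) : unitary ℂ →* unitary (CstarPerp D) where
  toFun z := z • 1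
  map_one' := one_smul _ _
  map_mul' z w := by
    apply Subtype.ext
    simp only [Unitary.coe_smul, Submonoid.coe_mul, OneMemClass.coe_one]
    rw [smul_mul_smul_comm, one_mul]

section
variable {q : ℕ} [NeZero q] {D : AddSubgroup (G q)}

theorem coe_phase_mul (z : unitary ℂ) (u : unitary (CstarPerp D)) :
    ((phase D z * u : unitary (CstarPerp D)) : CstarPerp D) = (z : ℂ) • (u : CstarPerp D) := by
  simp only [phase, MonoidHom.coe_mk, OneHom.coe_mk, Submonoid.coe_mul, Unitary.coe_smul,
    OneMemClass.coe_one]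
  exact smul_one_mul (z : ℂ) (u : CstarPerp D)

theorem commute_phase (u : unitary (CstarPerp D)) (z : unitary ℂ) : Commute u (phase D z) := by
  apply Subtype.ext
  rw [coe_phase_mul]
  simp only [phase, MonoidHom.coe_mk, OneHom.coe_mk, Submonoid.coe_mul, Unitary.coe_smul,
    OneMemClass.coe_one]
  exact mul_smul_one (z : ℂ) (u : CstarPerp D)

theorem piStar_mul_eq {x y : G q} (hx : x ∈ perp D) (hy : y ∈ perp D) (z : unitary ℂ)
    (hz : cocyc x y * (starRingEnd ℂ) (cocyc y x) = z) :
    piStar D x hx * piStar D y hy = phase D z * (piStar D y hy * piStar D x hx) := by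
  apply Subtype.ext
  rw [coe_phase_mul, ← hz]
  apply Subtype.ext
  change star (heis x : L2M q →L[ℂ] L2M q) * star (heis y : L2M q →L[ℂ] L2M q) =
    (cocyc x y * (starRingEnd ℂ) (cocyc y x)) •
      (star (heis y : L2M q →L[ℂ] L2M q) * star (heis x : L2M q →L[ℂ] L2M q))
  have h1 : cocyc x y * (starRingEnd ℂ) (cocyc x y) = 1 := by
    rw [Complex.mul_conj, Complex.normSq_eq_norm_sq, cocyc, norm_pair]; simp
  rw [← star_mul, ← star_mul, heis_mul, heis_mul, star_smul, star_smul, smul_smul, add_comm y x]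
  congr 1
  change (starRingEnd ℂ) (cocyc y x) = _ * (starRingEnd ℂ) (cocyc x y)
  linear_combination (-(starRingEnd ℂ) (cocyc y x)) * h1

theorem commute_piStar {x y : G q} (hx : x ∈ perp D) (hy : y ∈ perp D)
    (h : cocyc x y * (starRingEnd ℂ) (cocyc y x) = 1) :
    Commute (piStar D x hx) (piStar D y hy) := by
  have := piStar_mul_eq hx hy 1 h
  rwa [map_one, one_mul] at this

end

theorem mem_unitary_of_norm_eq_one {z : ℂ} (hz : ‖z‖ = 1) : z ∈ unitary ℂ := by
  rw [Unitary.mem_iff_self_mul_star]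
  change z * (starRingEnd ℂ) z = 1
  rw [Complex.mul_conj, Complex.normSq_eq_norm_sq, hz]; simp

/-- The number `e(t)`, as a unitary. -/
def unitaryE (t : ℝ) : unitary ℂ := ⟨e t, mem_unitary_of_norm_eq_one (norm_e t)⟩

theorem unitaryE_zpow (t : ℝ) (n : ℤ) : unitaryE t ^ n = unitaryE (t * n) := by
  apply Subtype.ext
  rw [Unitary.coe_zpow]
  change e t ^ n = e (t * n)
  rw [e, e, ← Complex.exp_int_mul]; congr 1; push_cast; ring

/-- The number `e(k/q)`, as a unitary. -/
def unitaryChar {q : ℕ} [NeZero q] (k : ZMod q) : unitary ℂ :=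
  ⟨ZMod.stdAddChar k, mem_unitary_of_norm_eq_one (AddChar.norm_apply _ _)⟩

/-- The phases `e(k²/q)` and `e(1/q)^(-k²)` cancel. -/
theorem unitaryChar_mul_zpow {q : ℕ} [NeZero q] (k : ℤ) :
    unitaryChar (((-k : ℤ) : ZMod q) * ((-k : ℤ) : ZMod q)) *
      unitaryChar (1 : ZMod q) ^ (-k * k) = 1 := by
  apply Subtype.ext
  rw [Submonoid.coe_mul, Unitary.coe_zpow]
  change ZMod.stdAddChar _ * ZMod.stdAddChar 1 ^ _ = (1 : ℂ)
  rw [← AddChar.map_zsmul_eq_zpow, ← AddChar.map_add_eq_mul,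
    ← AddChar.map_zero_eq_one (ZMod.stdAddChar (N := q))]
  congr 1
  rw [zsmul_one]; push_cast; ring

namespace Datum

theorem V₁_mul_V₂ (d : Datum) :
    d.V₁ * d.V₂ = phase d.D (unitaryE (d.β ^ 2) *
      unitaryChar (((-d.p₀ : ℤ) : ZMod d.q) * ((-d.p₀ : ℤ) : ZMod d.q))) * (d.V₂ * d.V₁) := by
  refine piStar_mul_eq d.δ₁_mem d.δ₂_mem _ ?_
  simp [cocyc, pair, δ₁, δ₂, e, unitaryE, unitaryChar, sq]

theorem V₃_mul_V₄ (d : Datum) :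
    d.V₃ * d.V₄ = phase d.D (unitaryChar (1 : ZMod d.q)) * (d.V₄ * d.V₃) := by
  refine piStar_mul_eq d.δ₃_mem d.δ₄_mem _ ?_
  simp [cocyc, pair, δ₃, δ₄, e, unitaryChar]

theorem commute_V₁_V₄ (d : Datum) : Commute d.V₁ d.V₄ := by
  refine commute_piStar d.δ₁_mem d.δ₄_mem ?_
  simp [cocyc, pair, δ₁, δ₄, e]

theorem commute_V₂_V₃ (d : Datum) : Commute d.V₂ d.V₃ := by
  refine commute_piStar d.δ₂_mem d.δ₃_mem ?_
  simp [cocyc, pair, δ₂, δ₃, e]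

/-- The factor `e(p₀²/q)` coming from `V₁, V₂` cancels the one coming from `V₃, V₄`. -/
theorem W₁_mul_W₂ (d : Datum) :
    d.W₁ * d.W₂ = phase d.D (unitaryE (d.β ^ 2)) * (d.W₂ * d.W₁) := by
  have h34 := zpow_mul_zpow_of_mul_eq (commute_phase d.V₃ _) (commute_phase d.V₄ _)
    d.V₃_mul_V₄ (-d.p₀) d.p₀
  have h := mul_mul_swap d.V₁_mul_V₂ h34 (d.commute_V₁_V₄.zpow_right d.p₀)
    (d.commute_V₂_V₃.zpow_right (-d.p₀)) ((commute_phase _ _).zpow_right _)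
    ((commute_phase _ _).zpow_right _)
  have hz : unitaryE (d.β ^ 2) *
      unitaryChar (((-d.p₀ : ℤ) : ZMod d.q) * ((-d.p₀ : ℤ) : ZMod d.q)) *
        unitaryChar (1 : ZMod d.q) ^ (-d.p₀ * d.p₀) = unitaryE (d.β ^ 2) := by
    rw [mul_assoc, unitaryChar_mul_zpow, mul_one]
  have hz' := congrArg (phase d.D) hz
  rw [map_mul, map_zpow] at hz'
  exact h.trans (congrArg (· * _) hz')

theorem W₁_zpow_mul_W₂_zpow (d : Datum) (m n : ℤ) :
    d.W₁ ^ m * d.W₂ ^ n =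
      phase d.D (unitaryE (d.β ^ 2 * (m * n))) * (d.W₂ ^ n * d.W₁ ^ m) := by
  rw [zpow_mul_zpow_of_mul_eq (commute_phase _ _) (commute_phase _ _) d.W₁_mul_W₂ m n,
    ← map_zpow, unitaryE_zpow]
  push_cast; rfl

theorem star_W_zpow (d : Datum) (m n : ℤ) :
    star (((d.W₁ ^ m * d.W₂ ^ n : unitary d.A)) : d.A) =
      e (-(d.β ^ 2 * (m * n))) • ((d.W₁ ^ (-m) * d.W₂ ^ (-n) : unitary d.A) : d.A) := by
  have h1 : star (d.W₁ ^ m * d.W₂ ^ n) =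
      phase d.D (unitaryE (-(d.β ^ 2 * (m * n)))) * (d.W₁ ^ (-m) * d.W₂ ^ (-n)) := by
    rw [W₁_zpow_mul_W₂_zpow d (-m) (-n), ← mul_assoc, ← map_mul]
    have h2 : unitaryE (-(d.β ^ 2 * (m * n))) * unitaryE (d.β ^ 2 * ((-m : ℤ) * (-n : ℤ))) =
        1 := by
      apply Subtype.ext
      change e _ * e _ = 1
      rw [← e_add]; push_cast
      rw [neg_mul_neg, neg_add_cancel]; simp [e]
    rw [h2, map_one, one_mul, Unitary.star_eq_inv, mul_inv_rev, zpow_neg, zpow_neg]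
  rw [← Unitary.coe_star, h1, coe_phase_mul]
  rfl

end Datum

/-! ### Estimates in the C*-algebra -/

instance {q : ℕ} [NeZero q] (D : AddSubgroup (G q)) : CompleteSpace (CstarPerp D) :=
  (StarSubalgebra.isClosed_topologicalClosure _).completeSpace_coe

theorem norm_unitary_le_one {q : ℕ} [NeZero q] {D : AddSubgroup (G q)}
    (u : unitary (CstarPerp D)) : ‖(u : CstarPerp D)‖ ≤ 1 := by
  rcases subsingleton_or_nontrivial (CstarPerp D) with h | h
  · rw [Subsingleton.elim (u : CstarPerp D) 0, norm_zero]; exact zero_le_one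
  · exact (CStarRing.norm_of_mem_unitary u.2).le

theorem norm_smul_unitary_le {q : ℕ} [NeZero q] {D : AddSubgroup (G q)} (c : ℂ)
    (u : unitary (CstarPerp D)) : ‖c • (u : CstarPerp D)‖ ≤ ‖c‖ := by
  rw [norm_smul]
  exact mul_le_of_le_one_right (norm_nonneg _) (norm_unitary_le_one u)

/-- A selfadjoint element close to `2` is a positive operator. -/
theorem isPositive_of_norm_sub_two_le {E : Type*} [NormedAddCommGroup E] [InnerProductSpace ℂ E]
    [CompleteSpace E] {T : E →L[ℂ] E} (hT : IsSelfAdjoint T) (h : ‖T - 2‖ ≤ 2) :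
    T.IsPositive := by
  refine ⟨hT.isSymmetric, fun x => ?_⟩
  have h1 : T.reApplyInnerSelf x = 2 * ‖x‖ ^ 2 + (inner ℂ ((T - 2) x) x).re := by
    have h2 : (T - 2) x = T x - (2 : ℂ) • x := by
      rw [two_smul]; simp [← one_add_one_eq_two]
    rw [ContinuousLinearMap.reApplyInnerSelf, h2, inner_sub_left, inner_smul_left,
      inner_self_eq_norm_sq_to_K]
    simp [← Complex.ofReal_pow]
  have h3 : |(inner ℂ ((T - 2) x) x).re| ≤ 2 * ‖x‖ ^ 2 := by
    refine (Complex.abs_re_le_norm _).trans ((norm_inner_le_norm _ _).trans ?_)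
    have h4 := (T - 2).le_of_opNorm_le h x
    nlinarith [norm_nonneg x]
  rw [h1]
  linarith [neg_abs_le (inner ℂ ((T - 2) x) x).re]

namespace Datum

theorem β_pos (d : Datum) : 0 < d.β := by
  have := d.a_pos
  have : (0 : ℝ) < d.q := Nat.cast_pos.2 d.q_pos
  rw [β]; positivity

theorem q_lt_β_sq (d : Datum) : (d.q : ℝ) < d.β ^ 2 := by
  have hq : (0 : ℝ) < d.q := Nat.cast_pos.2 d.q_pos
  have ha := d.a_pos
  have h1 : d.a ^ 2 < 1 / (d.q : ℝ) ^ 3 := by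
    rw [a, Real.sq_sqrt (sub_pos.2 d.lt_theta).le]; exact d.close
  rw [lt_div_iff₀ (by positivity)] at h1
  rw [β, div_pow, one_pow, lt_div_iff₀ (by positivity)]
  linarith [show (d.q : ℝ) * (d.q * d.a) ^ 2 = d.a ^ 2 * (d.q : ℝ) ^ 3 by ring]

theorem α_pos (d : Datum) (hq : 4 ≤ d.q) : 0 < d.α := by
  have h1 : (4 : ℝ) ≤ d.q := by exact_mod_cast hq
  have := d.q_lt_β_sq
  rw [α]; exact Real.sqrt_pos.2 (by linarith)

theorem β_sq (d : Datum) (hq : 4 ≤ d.q) : d.β ^ 2 = 4 * (d.α ^ 2 + 1) := by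
  have h1 : (4 : ℝ) ≤ d.q := by exact_mod_cast hq
  have := d.q_lt_β_sq
  rw [α, Real.sq_sqrt (by linarith)]; ring

theorem tendsto_α : Tendsto Datum.α (comap Datum.q atTop) atTop := by
  have h1 : Tendsto (fun n : ℕ => Real.sqrt ((n : ℝ) / 4 - 1)) atTop atTop :=
    Real.tendsto_sqrt_atTop.comp (tendsto_atTop_add_const_right _ _
      (tendsto_natCast_atTop_atTop.atTop_div_const (by norm_num)))
  refine tendsto_atTop_mono (fun d => ?_) (h1.comp tendsto_comap)
  rw [α]
  refine Real.sqrt_le_sqrt ?_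
  have := d.q_lt_β_sq
  linarith

theorem eventually_four_le : ∀ᶠ d : Datum in comap Datum.q atTop, 4 ≤ d.q :=
  tendsto_comap.eventually (eventually_ge_atTop 4)

theorem norm_bTerm_le (d : Datum) (hq : 4 ≤ d.q) (n : ℤ × ℤ) :
    ‖d.bTerm n‖ ≤ gauss (d.α * d.β ^ 2 / 2) n.1 * rowCoeff d.α n.2 :=
  (norm_smul_unitary_le _ _).trans (norm_H_le (d.α_pos hq) (d.β_sq hq) n.1 n.2)

theorem bTerm_zero (d : Datum) (hq : 4 ≤ d.q) (m : ℤ) : d.bTerm (0, m) = d.psi0Term m := by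
  rw [bTerm, psi0Term, psiCoeff_zero (d.α_pos hq) (d.β_sq hq), Int.cast_zero, zero_mul,
    H_zero (d.α_pos hq) (d.β_sq hq), zpow_zero, one_mul]

theorem bound_pos (d : Datum) (hq : 4 ≤ d.q) : 0 < d.α * d.β ^ 2 / 2 := by
  have := d.α_pos hq
  have := d.β_pos
  positivity

/-- The majorant of the series of `b` is a product of a series in `n₁` and a series in `n₂`. -/
theorem hasSum_bound (d : Datum) (hq : 4 ≤ d.q) :
    HasSum (fun n : ℤ × ℤ => gauss (d.α * d.β ^ 2 / 2) n.1 * rowCoeff d.α n.2)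
      (gaussSum (d.α * d.β ^ 2 / 2) 0 * rowTotal d.α) := by
  have h1 := hasSum_gauss (d.bound_pos hq) 0
  simp only [add_zero] at h1
  have h2 := hasSum_rowCoeff (d.α_pos hq)
  exact h1.mul h2 (h1.summable.mul_of_nonneg h2.summable (fun _ => (gauss_pos _ _).le)
    (rowCoeff_nonneg _))

theorem summable_bTerm (d : Datum) (hq : 4 ≤ d.q) : Summable d.bTerm :=
  Summable.of_norm_bounded (d.hasSum_bound hq).summable (d.norm_bTerm_le hq)

theorem summable_psi0Term (d : Datum) (hq : 4 ≤ d.q) : Summable d.psi0Term := by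
  refine ((d.summable_bTerm hq).comp_injective (Prod.mk_right_injective (0 : ℤ))).congr ?_
  exact fun m => d.bTerm_zero hq m

/-- The norm of `b - ψ₀` is at most the sum of the majorant over `n₁ ≠ 0`. -/
theorem norm_b_sub_psi0_le (d : Datum) (hq : 4 ≤ d.q) :
    ‖d.b - d.psi0‖ ≤ (gaussSum (d.α * d.β ^ 2 / 2) 0 - 1) * rowTotal d.α := by
  have hinj := Prod.mk_right_injective (β := ℤ) (0 : ℤ)
  have hrow {X : Type} [AddCommMonoid X] [TopologicalSpace X] {f : ℤ × ℤ → X} {g : ℤ → X} {s : X}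
      (hfg : ∀ m, f (0, m) = g m) (hg : HasSum g s) :
      HasSum (fun n : ℤ × ℤ => if n.1 = 0 then f n else 0) s := by
    refine (hinj.hasSum_iff ?_).1 (hg.congr_fun fun m => ?_)
    · rintro ⟨n, m⟩ hn
      exact if_neg fun h0 : n = 0 => hn ⟨m, by rw [h0]⟩
    · simp [hfg]
  have h1 := (d.summable_bTerm hq).hasSum.sub
    (hrow (d.bTerm_zero hq) (d.summable_psi0Term hq).hasSum)
  have h2 := (d.hasSum_bound hq).sub (hrow (f := fun n : ℤ × ℤ =>
    gauss (d.α * d.β ^ 2 / 2) n.1 * rowCoeff d.α n.2) (g := rowCoeff d.α)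
    (fun m => by simp [gauss_zero]) (hasSum_rowCoeff (d.α_pos hq)))
  rw [b, psi0, ← h1.tsum_eq, sub_one_mul]
  refine tsum_of_norm_bounded h2 fun n => ?_
  by_cases hn : n.1 = 0
  · simp [hn]
  · simpa [hn] using d.norm_bTerm_le hq n

/-- The coefficients of `ψ₀` are nonnegative and the one at `0` is at least `2`, so that
`‖ψ₀ - 2‖` is at most their sum minus `2`. -/
theorem norm_psi0_sub_two_le (d : Datum) (hq : 4 ≤ d.q) : ‖d.psi0 - 2‖ ≤ rowTotal d.α - 2 := by
  have h1 := (d.summable_psi0Term hq).hasSum.sub (hasSum_ite_eq (0 : ℤ) (2 : d.A))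
  have h2 := (hasSum_rowCoeff (d.α_pos hq)).sub (hasSum_ite_eq (0 : ℤ) (2 : ℝ))
  rw [psi0, ← h1.tsum_eq]
  refine tsum_of_norm_bounded h2 fun m => ?_
  by_cases hm : m = 0
  · have h3 : d.psi0Term 0 - 2 = ((rowCoeff d.α 0 - 2 : ℝ) : ℂ) • ((1 : unitary d.A) : d.A) := by
      rw [psi0Term, psiCoeff_zero (d.α_pos hq) (d.β_sq hq), zpow_zero, Complex.ofReal_sub,
        sub_smul]
      congr 1
      rw [Complex.ofReal_ofNat, two_smul, OneMemClass.coe_one, one_add_one_eq_two]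
    rw [if_pos hm, if_pos hm, hm, h3]
    refine (norm_smul_unitary_le _ _).trans (le_of_eq ?_)
    rw [Complex.norm_real, Real.norm_of_nonneg (sub_nonneg.2 (two_le_rowCoeff (d.α_pos hq)))]
  · rw [if_neg hm, if_neg hm, sub_zero, sub_zero, psi0Term,
      psiCoeff_zero (d.α_pos hq) (d.β_sq hq)]
    refine (norm_smul_unitary_le _ _).trans (le_of_eq ?_)
    rw [Complex.norm_real, Real.norm_of_nonneg (rowCoeff_nonneg _ _)]

theorem tendsto_norm_b_sub_psi0 :
    Tendsto (fun d : Datum => ‖d.b - d.psi0‖) (comap Datum.q atTop) (𝓝 0) := by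
  have h1 : Tendsto (fun d : Datum => d.α * d.β ^ 2 / 2) (comap Datum.q atTop) atTop := by
    refine tendsto_atTop_mono' _ ?_ tendsto_α
    filter_upwards [eventually_four_le] with d hq
    have := d.α_pos hq
    rw [d.β_sq hq]
    nlinarith [pow_pos this 3]
  have h2 := ((tendsto_gaussSum_zero.comp h1).sub_const 1).mul (tendsto_rowTotal.comp tendsto_α)
  rw [sub_self, zero_mul] at h2
  refine squeeze_zero' (Eventually.of_forall fun _ => norm_nonneg _) ?_ h2
  filter_upwards [eventually_four_le] with d hq using d.norm_b_sub_psi0_le hq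

theorem tendsto_norm_b_sub_two :
    Tendsto (fun d : Datum => ‖d.b - 2‖) (comap Datum.q atTop) (𝓝 0) := by
  have h1 := tendsto_norm_b_sub_psi0.add ((tendsto_rowTotal.comp tendsto_α).sub_const 2)
  rw [sub_self, zero_add] at h1
  refine squeeze_zero' (Eventually.of_forall fun _ => norm_nonneg _) ?_ h1
  filter_upwards [eventually_four_le] with d hq
  rw [← sub_add_sub_cancel d.b d.psi0 2]
  exact (norm_add_le _ _).trans (add_le_add_right (d.norm_psi0_sub_two_le hq) _)

/-- The phase in the adjoint symmetry of `H` cancels the one in the commutation relation of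
`W₁` and `W₂`. -/
theorem star_bTerm (d : Datum) (n : ℤ × ℤ) : star (d.bTerm n) = d.bTerm (-n) := by
  rw [bTerm, bTerm, star_smul, star_W_zpow, smul_smul, Prod.fst_neg, Prod.snd_neg]
  congr 1
  change (starRingEnd ℂ) _ * _ = _
  have h1 : e (n.1 * d.β * (n.2 * d.β)) * e (-(d.β ^ 2 * (n.1 * n.2))) = 1 := by
    rw [← e_add, show n.1 * d.β * (n.2 * d.β) + -(d.β ^ 2 * (n.1 * n.2)) = 0 by ring]
    simp [e]
  rw [map_mul, Complex.conj_ofReal, conj_H, Int.cast_neg, Int.cast_neg, neg_mul, neg_mul]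
  linear_combination
    ((Real.sqrt (2 * d.α) : ℂ) * H d.α d.β (-(n.1 * d.β)) (-(n.2 * d.β))) * h1

theorem isSelfAdjoint_b (d : Datum) : IsSelfAdjoint d.b := by
  rw [IsSelfAdjoint, b, tsum_star]
  simp only [star_bTerm]
  exact (Equiv.neg (ℤ × ℤ)).tsum_eq d.bTerm

theorem isUnit_b_of_norm_sub_two_lt (d : Datum) (h : ‖d.b - 2‖ < 2) : IsUnit d.b := by
  have h1 : ‖(1 / 2 : ℂ) • (2 - d.b)‖ < 1 := by
    rw [norm_smul, norm_sub_rev, norm_div, norm_one, Complex.norm_ofNat]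
    linarith
  have h2 : d.b = (2 : ℂ) • (1 - (1 / 2 : ℂ) • (2 - d.b)) := by
    rw [smul_sub, smul_smul, two_smul, one_add_one_eq_two]
    norm_num
  rw [h2]
  exact (isUnit_one_sub_of_norm_lt_one h1).smul (Units.mk0 (2 : ℂ) two_ne_zero)

end Datum

end FourierProj

end

theorem lemma3p1 :
    (∀ d : FourierProj.Datum, 4 ≤ d.q → Summable d.bTerm ∧ Summable d.psi0Term) ∧
    Tendsto (fun d : FourierProj.Datum => ‖d.b - d.psi0‖)
      (comap FourierProj.Datum.q atTop) (𝓝 0) ∧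
    Tendsto (fun d : FourierProj.Datum => ‖d.b - 2‖)
      (comap FourierProj.Datum.q atTop) (𝓝 0) ∧
    (∀ᶠ d : FourierProj.Datum in comap FourierProj.Datum.q atTop,
      IsUnit d.b ∧
        (d.b : FourierProj.L2M d.q →L[ℂ] FourierProj.L2M d.q).IsPositive) := by
  refine ⟨fun d hq => ⟨d.summable_bTerm hq, d.summable_psi0Term hq⟩,
    FourierProj.Datum.tendsto_norm_b_sub_psi0, FourierProj.Datum.tendsto_norm_b_sub_two, ?_⟩
  filter_upwards [FourierProj.Datum.tendsto_norm_b_sub_two.eventually_lt_const two_pos] with d hd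
  refine ⟨d.isUnit_b_of_norm_sub_two_lt hd, ?_⟩
  refine FourierProj.isPositive_of_norm_sub_two_le ?_ hd.le
  exact congrArg Subtype.val d.isSelfAdjoint_b
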